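/- Let $k\ge 2$, and let $\mathcal S_n$ denote the set of permutations of $\{1,\dots,n\}$. For $\sigma\in\mathcal S_n$ and an interval $I\subseteq\{1,\dots,n\}$ with $|I|=k$, let $\mathrm{pat}_I(\sigma)\in\mathcal S_k$ be the permutation whose entries are in the same relative order as $(\sigma(i))_{i\in I}$. For $\pi\in\mathcal S_k$ let $$\widetilde{\mathrm{c\text{-}occ}}(\pi,\sigma)=\frac1n\,\bigl|\{I\subseteq\{1,\dots,n\}\text{ an interval}: |I|=k,\ \mathrm{pat}_I(\sigma)=\pi\}\bigr|.$$ Let the feasible region $P_k$ be the set of all $\vec v\in[0,1]^{\mathcal S_k}$ for which there is a sequence of permutations $(\sigma^m)_{m}$ whose sizes tend to infinity such that $\widetilde{\mathrm{c\text{-}occ}}(\pi,\sigma^m)\to v_\pi$ for every $\pi\in\mathcal S_k$. For $\pi\in\mathcal S_k$ let $\mathrm{beg}(\pi),\mathrm{end}(\pi)\in\mathcal S_{k-1}$ be the patterns of its first, respectively last, $k-1$ entries. The overlap graph $\mathcal{O}v(k)$ is the directed multigraph with vertex set $\mathcal S_{k-1}$ and with one edge $\mathrm{beg}(\pi)\to\mathrm{end}(\pi)$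 for each $\pi\in\mathcal S_k$; edges are identified with their labels $\pi$. A simple cycle of a directed multigraph is a non-empty closed directed walk without repeated edges and without repeated vertices other than the coincidence of its first and last vertex (so a loop is a simple cycle). For a simple cycle $\mathcal C$ let $\vec e_{\mathcal C}$ be the vector indexed by the edges whose entry at $e$ is the number of times $\mathcal C$ traverses $e$, divided by the number $|\mathcal C|$ of edges of $\mathcal C$. The cycle polytope $P(G)$ of $G$ is the convex hull of the vectors $\vec e_{\mathcal C}$ over all simple cycles $\mathcal C$ of $G$. Then: 1. $P_k=P(\mathcal{O}v(k))$. 2. The set of vertices of the polytope $P_k$ (the least finite set whose convex hull is $P_k$, equivalently the set of extreme points of $P_k$) is $\{\vec e_{\mathcal C} : \mathcal C\text{ a simple cycle of }\mathcal{O}v(k)\}$. 3. The dimension of $P_k$ (that of its affine span) is $k!-(k-1)!$. 4. $$P_k=\Bigl\{\vec v\in[0,1]^{\mathcal S_k} : \sum_{\pi\in\mathcal S_k}v_\pi=1,\ \sum_{\mathrm{beg}(\pi)=\rho}v_\pi=\sum_{\mathrm{end}(\pi)=\rho}v_\pi\ \text{ for all }\rho\in\mathcal S_{k-1}\Bigr\}.$$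 -/

import Mathlib

open Filter Topology
open scoped Nat

namespace ConsecutivePatterns

/-- The standardization of a sequence `x` of distinct elements of a linear order: the permutation
whose entries are in the same relative order as `x` (see `std_lt_std_iff`). The permutation
`Tuple.sort x` lists the positions by increasing value, so its inverse gives each position its
rank. -/
def std {α : Type*} [LinearOrder α] {n : ℕ} (x : Fin n → α) : Equiv.Perm (Fin n) :=
  (Tuple.sort x).symm

theorem std_lt_std_iff {α : Type*} [LinearOrder α] {n : ℕ} {x : Fin n → α}
    (hx : Function.Injective x) (i j : Fin n) : std x i < std x j ↔ x i < x j := by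
  have h : StrictMono (x ∘ Tuple.sort x) :=
    (Tuple.monotone_sort x).strictMono_of_injective (hx.comp (Tuple.sort x).injective)
  have := h.lt_iff_lt (a := std x i) (b := std x j)
  simpa [std] using this.symm

/-- The pattern induced by `σ` on the interval of the `k` consecutive (zero-based) positions
`i, i + 1, …, i + k - 1`. -/
def windowPattern {n k : ℕ} (σ : Equiv.Perm (Fin n)) (i : ℕ) (h : i + k ≤ n) :
    Equiv.Perm (Fin k) :=
  std fun j : Fin k => σ ⟨i + j, by omega⟩

/-- The number of consecutive occurrences of `π` (of size `k ≥ 1`) in `σ`: the number of intervals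
of `k` positions, given by their first element, on which `σ` induces the pattern `π`. -/
def consecOcc {n k : ℕ} (π : Equiv.Perm (Fin k)) (σ : Equiv.Perm (Fin n)) : ℕ :=
  ((Finset.range n).filter fun i => ∃ h : i + k ≤ n, windowPattern σ i h = π).card

/-- The proportion of consecutive occurrences of `π` in `σ`; the denominator is the size of `σ`. -/
noncomputable def consecProp {n k : ℕ} (π : Equiv.Perm (Fin k)) (σ : Equiv.Perm (Fin n)) : ℝ :=
  (consecOcc π σ : ℝ) / n

/-- The feasible region for consecutive patterns of size `k`: the vectors of limiting proportions
along sequences of permutations whose size tends to infinity. -/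
def feasibleRegion (k : ℕ) : Set (Equiv.Perm (Fin k) → ℝ) :=
  {v | (∀ π, v π ∈ Set.Icc (0 : ℝ) 1) ∧
    ∃ σ : ℕ → Σ n : ℕ, Equiv.Perm (Fin n),
      Tendsto (fun m => (σ m).1) atTop atTop ∧
      ∀ π, Tendsto (fun m => consecProp π (σ m).2) atTop (𝓝 (v π))}

/-- A directed multigraph with vertices `V` and edges `E`; loops and parallel edges are allowed. -/
structure DiMultigraph (V E : Type*) where
  /-- starting vertex of an edge -/
  st : E → V
  /-- arrival vertex of an edge -/
  ar : E → V

namespace DiMultigraph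

variable {V E : Type*} (G : DiMultigraph V E)

/-- A walk: a sequence of edges, each starting where the previous one arrives. -/
def IsWalk (w : List E) : Prop :=
  w.IsChain fun e e' => G.ar e = G.st e'

/-- A non-empty cycle. -/
def IsCycle (w : List E) : Prop :=
  G.IsWalk w ∧ ∃ h : w ≠ [], G.st (w.head h) = G.ar (w.getLast h)

/-- A path: the edges are distinct, and so are the vertices `v₀, …, v_ℓ` visited, except that
`v₀ = v_ℓ` may happen; that is, `v₀, …, v_{ℓ-1}` are distinct and `v₁, …, v_ℓ` are distinct. -/
def IsPath (w : List E) : Prop :=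
  G.IsWalk w ∧ w.Nodup ∧ (w.map G.st).Nodup ∧ (w.map G.ar).Nodup

/-- A simple cycle: a non-empty cycle that is a path. -/
def IsSimpleCycle (w : List E) : Prop :=
  G.IsCycle w ∧ G.IsPath w

end DiMultigraph

/-- The vector `e_C` of a cycle `C`: the proportion of each edge among the edges of `C`. -/
noncomputable def cycleVector {E : Type*} [DecidableEq E] (C : List E) : E → ℝ :=
  fun e => (C.count e : ℝ) / C.length

/-- The set of the vectors `e_C` of the simple cycles `C` of `G`. -/
def DiMultigraph.simpleCycleVectors {V E : Type*} [DecidableEq E] (G : DiMultigraph V E) :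
    Set (E → ℝ) :=
  {x | ∃ C : List E, G.IsSimpleCycle C ∧ x = cycleVector C}

/-- The cycle polytope of `G`. -/
def DiMultigraph.cyclePolytope {V E : Type*} [DecidableEq E] (G : DiMultigraph V E) :
    Set (E → ℝ) :=
  convexHull ℝ G.simpleCycleVectors

/-- The pattern of the first `k - 1` entries of a permutation of size `k`. -/
def beginPattern {k : ℕ} (π : Equiv.Perm (Fin k)) : Equiv.Perm (Fin (k - 1)) :=
  std fun j : Fin (k - 1) => π ⟨j, by omega⟩

/-- The pattern of the last `k - 1` entries of a permutation of size `k`. -/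
def endPattern {k : ℕ} (π : Equiv.Perm (Fin k)) : Equiv.Perm (Fin (k - 1)) :=
  std fun j : Fin (k - 1) => π ⟨j + 1, by omega⟩

/-- The overlap graph of size `k`: an edge `beginPattern π → endPattern π` for each `π`. -/
def overlapGraph (k : ℕ) : DiMultigraph (Equiv.Perm (Fin (k - 1))) (Equiv.Perm (Fin k)) where
  st := beginPattern
  ar := endPattern

/-- `W` is the set of vertices of the polytope `P`: the least finite set whose convex hull
is `P`. -/
def IsVertexSet {F : Type*} [AddCommGroup F] [Module ℝ F] (P W : Set F) : Prop :=
  IsLeast {A : Set F | A.Finite ∧ convexHull ℝ A = P} W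

end ConsecutivePatterns

/-! Everything passes through `flowPolytope`, the nonnegative circulations of mass one. Sliding a
window along a permutation traces a walk in the overlap graph, so pattern counts conserve flow at
each vertex up to an error of 1, and limits of proportions are circulations
(`feasibleRegion_subset`). Conversely, every walk comes from a sequence of distinct rationals built
one entry at a time, because only the rank of the new entry among the preceding `K` is prescribed
(`exists_extension`). Running around a cycle realizes its vector, and placing one sequence after and
above another realizes convex combinations (`convex_approximable`).

On any finite multigraph, the support of such a circulation contains a simple cycle; splitting off a
small multiple of it shows that extreme points are simple cycle vectors. Conversely, a circulation
supported on a simple cycle is constant along it, so these vectors are extreme. Krein–Milman then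
gives the convex hull.

For the dimension, the uniform vector is a strictly positive circulation, so the affine span is cut
out by the linear equations alone. Connectedness leaves one dependency among the vertex equations,
which the mass equation replaces: the rank is the number of vertices. -/

namespace ConsecutivePatterns

/-! ### Edge counts in lists -/

section CycleCounts

variable {V E : Type*} [Fintype E] [DecidableEq V] [DecidableEq E]

theorem sum_filter_count (g : E → V) (C : List E) (ρ : V) :
    ∑ e with g e = ρ, C.count e = (C.map g).count ρ := by
  induction C with
  | nil => simp
  | cons a l ih =>
    simp only [List.count_cons, Finset.sum_add_distrib, ih, List.map_cons, beq_iff_eq,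
      Finset.sum_ite_eq, Finset.mem_filter, Finset.mem_univ, true_and]

theorem sum_count (C : List E) : ∑ e, C.count e = C.length := by
  induction C with
  | nil => simp
  | cons a l ih => simp [List.count_cons, Finset.sum_add_distrib, ih]

end CycleCounts

/-! ### Circulations and simple cycles of a finite multigraph -/

namespace DiMultigraph

variable {V E : Type*} (G : DiMultigraph V E)

/-- Both lists spell out the vertices visited by the walk, in order. For a cycle, the two extra end
vertices coincide and cancel in counts. -/
theorem IsWalk.st_cons_map_ar {e : E} {l : List E} (h : G.IsWalk (e :: l)) :
    G.st e :: (e :: l).map G.ar =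
      (e :: l).map G.st ++ [G.ar ((e :: l).getLast (by simp))] := by
  induction l generalizing e with
  | nil => simp
  | cons a l ih =>
    have h' : G.ar e = G.st a ∧ G.IsWalk (a :: l) := by
      simpa [IsWalk, List.isChain_cons_cons] using h
    have := ih h'.2
    rw [List.map_cons, h'.1, this]
    simp

theorem IsCycle.count_map_st_eq [DecidableEq V] {C : List E} (h : G.IsCycle C) (ρ : V) :
    (C.map G.st).count ρ = (C.map G.ar).count ρ := by
  obtain ⟨hw, hne, hc⟩ := h
  obtain ⟨e, l, rfl⟩ := List.exists_cons_of_ne_nil hne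
  have h2 := congrArg (List.count ρ) (IsWalk.st_cons_map_ar G hw)
  rw [List.count_cons, List.count_append, ← hc] at h2
  simp only [List.head_cons, List.count_singleton] at h2
  omega

theorem finite_simpleCycleVectors [Fintype E] [DecidableEq E] (G : DiMultigraph V E) :
    G.simpleCycleVectors.Finite := by
  have hfin : {C : List E | C.Nodup}.Finite := by
    refine (List.finite_length_le E (Fintype.card E)).subset fun C hC => ?_
    exact List.Nodup.length_le_card hC
  refine (hfin.image cycleVector).subset ?_
  rintro _ ⟨C, hC, rfl⟩
  exact ⟨C, hC.2.2.1, rfl⟩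

variable [Fintype E] [DecidableEq V]

/-- The nonnegative circulations of total mass one. -/
def flowPolytope : Set (E → ℝ) :=
  {v | (∀ e, v e ∈ Set.Icc (0 : ℝ) 1) ∧ ∑ e, v e = 1 ∧
    ∀ ρ : V, ∑ e with G.st e = ρ, v e = ∑ e with G.ar e = ρ, v e}

variable {G}

theorem mem_flowPolytope_of_nonneg {v : E → ℝ} (h0 : ∀ e, 0 ≤ v e) (h1 : ∑ e, v e = 1)
    (hf : ∀ ρ : V, ∑ e with G.st e = ρ, v e = ∑ e with G.ar e = ρ, v e) :
    v ∈ G.flowPolytope :=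
  ⟨fun e => ⟨h0 e, h1 ▸ Finset.single_le_sum (fun i _ => h0 i) (Finset.mem_univ e)⟩, h1, hf⟩

theorem cycleVector_mem_flowPolytope [DecidableEq E] {C : List E} (h : G.IsCycle C) :
    cycleVector C ∈ G.flowPolytope := by
  have hl : (C.length : ℝ) ≠ 0 := by
    obtain ⟨_, hne, _⟩ := h
    simpa using hne
  refine mem_flowPolytope_of_nonneg (fun e => ?_) ?_ fun ρ => ?_
  · unfold cycleVector; positivity
  · simp only [cycleVector]
    rw [← Finset.sum_div, ← Nat.cast_sum, sum_count, div_self hl]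
  · simp only [cycleVector]
    rw [← Finset.sum_div, ← Finset.sum_div, ← Nat.cast_sum, ← Nat.cast_sum,
      sum_filter_count, sum_filter_count, h.count_map_st_eq]

theorem convex_flowPolytope : Convex ℝ G.flowPolytope := by
  intro x hx y hy a b ha hb hab
  refine mem_flowPolytope_of_nonneg (fun e => ?_) ?_ fun ρ => ?_
  · have := (hx.1 e).1
    have := (hy.1 e).1
    simp only [Pi.add_apply, Pi.smul_apply, smul_eq_mul]
    positivity
  · simp [Finset.sum_add_distrib, ← Finset.mul_sum, hx.2.1, hy.2.1, hab]
  · simp [Finset.sum_add_distrib, ← Finset.mul_sum, hx.2.2, hy.2.2]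

theorem isCompact_flowPolytope : IsCompact G.flowPolytope := by
  have hK : IsCompact (Set.univ.pi fun _ : E => Set.Icc (0 : ℝ) 1) :=
    isCompact_univ_pi fun _ => isCompact_Icc
  refine hK.of_isClosed_subset ?_ fun v hv e _ => hv.1 e
  simp only [flowPolytope, Set.ofPred_and, Set.ofPred_forall]
  refine IsClosed.inter (isClosed_iInter fun e => ?_) (IsClosed.inter ?_ (isClosed_iInter fun ρ => ?_))
  · exact isClosed_Icc.preimage (continuous_apply e)
  · exact isClosed_eq (by fun_prop) (by fun_prop)
  · exact isClosed_eq (by fun_prop) (by fun_prop)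

/-- The support of a nonzero circulation contains a simple cycle. -/
theorem exists_isSimpleCycle_of_mem_flowPolytope [Finite V] {v : E → ℝ}
    (hv : v ∈ G.flowPolytope) : ∃ C : List E, G.IsSimpleCycle C ∧ ∀ e ∈ C, 0 < v e := by
  classical
  obtain ⟨h01, hsum, hflow⟩ := hv
  have hex : ∃ e, 0 < v e := by
    by_contra! hcon
    have : ∑ e, v e = 0 := Finset.sum_eq_zero fun e _ => le_antisymm (hcon e) (h01 e).1
    linarith
  obtain ⟨e₀, he₀⟩ := hex
  -- Conservation: positive inflow at the head of `e` forces an outgoing edge of positive weight.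
  have hnext : ∀ e, 0 < v e → ∃ e', 0 < v e' ∧ G.st e' = G.ar e := by
    intro e he
    have hpos : 0 < ∑ e' with G.ar e' = G.ar e, v e' :=
      lt_of_lt_of_le he
        (Finset.single_le_sum (f := v) (fun i _ => (h01 i).1) (by simp))
    rw [← hflow] at hpos
    by_contra! hcon
    refine hpos.ne' (Finset.sum_eq_zero fun e' he' => ?_)
    by_contra hne
    exact hcon e' (lt_of_le_of_ne (h01 e').1 (Ne.symm hne)) (by simpa using he')
  have : Nonempty E := ⟨e₀⟩
  -- The outgoing edge depends on the vertex only, so the walk iterates a self-map `g` of the finite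
  -- set `V`. It reaches a periodic point, and one minimal period visits distinct vertices.
  choose! nxt hnxt using fun (u : V) (hu : ∃ e, 0 < v e ∧ G.st e = u) => hu
  set g : V → V := fun u => G.ar (nxt u) with hg
  obtain ⟨e₁, he₁, hs₁⟩ := hnext e₀ he₀
  have hact : ∀ n, ∃ e, 0 < v e ∧ G.st e = g^[n] (G.ar e₀) := by
    intro n
    induction n with
    | zero => exact ⟨e₁, he₁, hs₁⟩
    | succ n ih =>
      rw [Function.iterate_succ_apply']
      exact hnext _ (hnxt _ ih).1
  obtain ⟨a, b, hab, heq⟩ := Finite.exists_ne_map_eq_of_infinite fun n => g^[n] (G.ar e₀)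
  wlog hlt : a < b generalizing a b
  · exact this b a hab.symm heq.symm (by omega)
  set u := g^[a] (G.ar e₀) with hu
  have hper : u ∈ Function.periodicPts g := by
    refine ⟨b - a, by omega, ?_⟩
    change g^[b - a] u = u
    rw [hu, ← Function.iterate_add_apply]
    have : b - a + a = b := by omega
    rw [this]
    exact heq.symm
  have hactu : ∀ n, ∃ e, 0 < v e ∧ G.st e = g^[n] u := by
    intro n
    rw [hu, ← Function.iterate_add_apply]
    exact hact _
  set L := Function.minimalPeriod g u with hL
  have hLpos : 0 < L := Function.minimalPeriod_pos_of_mem_periodicPts hper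
  have hinj : Set.InjOn (fun n => g^[n] u) (Set.Iio L) :=
    Function.iterate_injOn_Iio_minimalPeriod
  have hstn : ∀ n, G.st (nxt (g^[n] u)) = g^[n] u := fun n => (hnxt _ (hactu n)).2
  have harn : ∀ n, G.ar (nxt (g^[n] u)) = g^[n + 1] u := fun n => by
    rw [Function.iterate_succ_apply']
  have hLu : g^[L] u = u := Function.iterate_minimalPeriod
  have hwalk : G.IsWalk ((List.range L).map fun n => nxt (g^[n] u)) := by
    rw [IsWalk, List.isChain_map, List.isChain_range]
    intro m _
    rw [harn, hstn]
  have hst : (((List.range L).map fun n => nxt (g^[n] u)).map G.st).Nodup := by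
    rw [List.map_map]
    refine List.Nodup.map_on (fun x hx y hy hxy => ?_) List.nodup_range
    simp only [Function.comp, hstn] at hxy
    exact hinj (by simpa using hx) (by simpa using hy) hxy
  have har : (((List.range L).map fun n => nxt (g^[n] u)).map G.ar).Nodup := by
    rw [List.map_map]
    refine List.Nodup.map_on (fun x hx y hy hxy => ?_) List.nodup_range
    simp only [Function.comp, harn] at hxy
    have hx : x < L := by simpa using hx
    have hy : y < L := by simpa using hy
    -- Arrival vertices have indices `1, …, L`; index `L` wraps around to `0` before injectivity
    -- below `L` applies.
    by_cases hxL : x + 1 = L <;> by_cases hyL : y + 1 = L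
    · omega
    · rw [hxL, hLu] at hxy
      have := hinj (x₁ := 0) (x₂ := y + 1) hLpos (Set.mem_Iio.2 (by omega)) (by simpa using hxy)
      omega
    · rw [hyL, hLu] at hxy
      have := hinj (x₁ := x + 1) (x₂ := 0) (Set.mem_Iio.2 (by omega)) hLpos (by simpa using hxy)
      omega
    · have := hinj (x₁ := x + 1) (x₂ := y + 1) (Set.mem_Iio.2 (by omega))
        (Set.mem_Iio.2 (by omega)) hxy
      omega
  refine ⟨_, ⟨⟨hwalk, ?_, ?_⟩, hwalk, List.Nodup.of_map _ hst, hst, har⟩, fun e he => ?_⟩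
  · simp; omega
  · rw [List.head_map, List.getLast_map, harn, hstn]
    have h1 : (List.range L).head (by simp; omega) = 0 := by simp
    have h2 : (List.range L).getLast (by simp; omega) + 1 = L := by simp; omega
    rw [h1, h2, hLu]; rfl
  · obtain ⟨n, _, rfl⟩ := List.mem_map.1 he
    exact (hnxt _ (hactu n)).1

/-- If the support of `v` contains the cycle `C`, then `v` is a proper convex combination of
`cycleVector C` and the normalized remainder; extremality forces `v = cycleVector C`. -/
theorem extremePoints_flowPolytope_subset [Finite V] [DecidableEq E] :
    Set.extremePoints ℝ G.flowPolytope ⊆ G.simpleCycleVectors := by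
  intro v hv
  obtain ⟨hvQ, hext⟩ := mem_extremePoints.1 hv
  obtain ⟨C, hC, hpos⟩ := exists_isSimpleCycle_of_mem_flowPolytope hvQ
  refine ⟨C, hC, ?_⟩
  have hcQ := cycleVector_mem_flowPolytope hC.1
  obtain ⟨t, ht0, ht1, ht⟩ : ∃ t : ℝ, 0 < t ∧ t < 1 ∧ ∀ e, t * cycleVector C e ≤ v e := by
    have hev : ∀ᶠ t in 𝓝[>] (0 : ℝ), ∀ e, t * cycleVector C e ≤ v e := by
      rw [eventually_all]
      intro e
      by_cases he : e ∈ C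
      · have hcont : Tendsto (fun t : ℝ => t * cycleVector C e) (𝓝[>] 0) (𝓝 0) := by
          have : Tendsto (fun t : ℝ => t * cycleVector C e) (𝓝 0) (𝓝 (0 * cycleVector C e)) :=
            (continuous_id.mul continuous_const).tendsto 0
          rw [zero_mul] at this
          exact this.mono_left nhdsWithin_le_nhds
        exact (hcont.eventually (gt_mem_nhds (hpos e he))).mono fun _ h => h.le
      · have : cycleVector C e = 0 := by simp [cycleVector, List.count_eq_zero_of_not_mem he]
        simp [this, (hvQ.1 e).1]
    have hlt : ∀ᶠ t in 𝓝[>] (0 : ℝ), t < 1 :=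
      nhdsWithin_le_nhds (gt_mem_nhds one_pos)
    obtain ⟨t, h1, h2, h3⟩ := (hev.and (hlt.and self_mem_nhdsWithin)).exists
    exact ⟨t, h3, h2, h1⟩
  have h1t : 0 < 1 - t := by linarith
  have hw : (1 - t)⁻¹ • (v - t • cycleVector C) ∈ G.flowPolytope := by
    refine mem_flowPolytope_of_nonneg (fun e => ?_) ?_ fun ρ => ?_
    · have := ht e
      simp only [Pi.smul_apply, Pi.sub_apply, smul_eq_mul]
      exact mul_nonneg (inv_nonneg.2 h1t.le) (by linarith)
    · simp only [Pi.smul_apply, Pi.sub_apply, smul_eq_mul, ← Finset.mul_sum,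
        Finset.sum_sub_distrib, hvQ.2.1, hcQ.2.1, mul_one]
      exact inv_mul_cancel₀ h1t.ne'
    · simp only [Pi.smul_apply, Pi.sub_apply, smul_eq_mul, ← Finset.mul_sum,
        Finset.sum_sub_distrib, hvQ.2.2, hcQ.2.2]
  refine (hext _ hcQ _ hw ⟨t, 1 - t, ht0, h1t, by ring, ?_⟩).1.symm
  rw [smul_smul, mul_inv_cancel₀ h1t.ne', one_smul]
  abel

/-- Krein–Milman; the closure is harmless because the hull of a finite set is compact. -/
theorem flowPolytope_eq_cyclePolytope [Finite V] [DecidableEq E] :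
    G.flowPolytope = G.cyclePolytope := by
  refine Set.Subset.antisymm ?_ (convexHull_min ?_ convex_flowPolytope)
  · rw [← closure_convexHull_extremePoints isCompact_flowPolytope convex_flowPolytope]
    refine closure_minimal (convexHull_mono extremePoints_flowPolytope_subset) ?_
    exact ((finite_simpleCycleVectors G).isCompact_convexHull ℝ).isClosed
  · rintro _ ⟨C, hC, rfl⟩
    exact cycleVector_mem_flowPolytope hC.1

/-- A circulation of mass one supported on a simple cycle is the vector of the cycle. -/
theorem eq_cycleVector_of_support_subset [DecidableEq E] {C : List E} (hC : G.IsSimpleCycle C)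
    {x : E → ℝ} (hx : x ∈ G.flowPolytope) (hsupp : ∀ e ∉ C, x e = 0) : x = cycleVector C := by
  obtain ⟨⟨hw, hne, _⟩, _, hnd, hst, har⟩ := hC
  have key : ∀ (g : E → V), (C.map g).Nodup → ∀ e ∈ C, ∑ e' with g e' = g e, x e' = x e := by
    intro g hg e he
    refine Finset.sum_eq_single e (fun b hb hbe => ?_) fun h => absurd (by simp) h
    by_contra hxb
    have hbC : b ∈ C := by
      by_contra hbC
      exact hxb (hsupp b hbC)
    exact hbe (List.inj_on_of_nodup_map hg hbC he (by simpa using hb))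
  -- At the vertex joining consecutive edges, only `e` can carry inflow and only `e'` outflow, so
  -- conservation equates their weights.
  have hchain : C.IsChain fun e e' => x e = x e' := by
    refine hw.imp_of_mem_imp fun e e' he he' h => ?_
    rw [← key G.ar har e he, ← key G.st hst e' he', h, hx.2.2]
  have hpw : C.Pairwise fun e e' => x e = x e' :=
    haveI : Trans (fun e e' => x e = x e') (fun e e' => x e = x e') (fun e e' => x e = x e') :=
      ⟨fun h h' => h.trans h'⟩
    hchain.pairwise
  obtain ⟨a, l, rfl⟩ := List.exists_cons_of_ne_nil hne
  have hconst : ∀ e ∈ a :: l, x e = x a := by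
    intro e he
    rcases List.mem_cons.1 he with rfl | he
    · rfl
    · exact ((List.pairwise_cons.1 hpw).1 e he).symm
  have hxc : ∀ e, x e = ((a :: l).count e : ℝ) * x a := by
    intro e
    by_cases he : e ∈ a :: l
    · rw [List.count_eq_one_of_mem hnd he, hconst e he, Nat.cast_one, one_mul]
    · rw [hsupp e he, List.count_eq_zero_of_not_mem he, Nat.cast_zero, zero_mul]
  have hs := hx.2.1
  rw [Finset.sum_congr rfl fun e _ => hxc e, ← Finset.sum_mul, ← Nat.cast_sum, sum_count] at hs
  funext e
  rw [hxc e, cycleVector, eq_div_iff (left_ne_zero_of_mul_eq_one hs), mul_assoc, mul_comm (x a), hs,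
    mul_one]

theorem extremePoints_flowPolytope [Finite V] [DecidableEq E] :
    Set.extremePoints ℝ G.flowPolytope = G.simpleCycleVectors := by
  refine Set.Subset.antisymm extremePoints_flowPolytope_subset ?_
  rintro _ ⟨C, hC, rfl⟩
  refine mem_extremePoints.2 ⟨cycleVector_mem_flowPolytope hC.1, ?_⟩
  rintro x hx y hy ⟨a, b, ha, hb, hab, hxy⟩
  have hz : ∀ e ∉ C, x e = 0 ∧ y e = 0 := by
    intro e he
    have h := congrFun hxy e
    simp only [Pi.add_apply, Pi.smul_apply, smul_eq_mul, cycleVector,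
      List.count_eq_zero_of_not_mem he, Nat.cast_zero, zero_div] at h
    have h1 := mul_nonneg ha.le (hx.1 e).1
    have h2 := mul_nonneg hb.le (hy.1 e).1
    exact ⟨(mul_eq_zero.1 (by linarith : a * x e = 0)).resolve_left ha.ne',
      (mul_eq_zero.1 (by linarith : b * y e = 0)).resolve_left hb.ne'⟩
  exact ⟨eq_cycleVector_of_support_subset hC hx fun e he => (hz e he).1,
    eq_cycleVector_of_support_subset hC hy fun e he => (hz e he).2⟩

theorem isVertexSet_flowPolytope [Finite V] [DecidableEq E] :
    IsVertexSet G.flowPolytope G.simpleCycleVectors := by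
  refine ⟨⟨finite_simpleCycleVectors G, flowPolytope_eq_cyclePolytope.symm⟩, ?_⟩
  rintro A ⟨_, hA⟩
  rw [← extremePoints_flowPolytope, ← hA]
  exact extremePoints_convexHull_subset

/-! ### Dimension of the polytope of circulations -/

section Dimension

variable (G)

/-- The incidence matrix of `G`, shifted by one: its kernel consists of the circulations of total
mass zero. -/
def shiftedIncidence : Matrix V E ℝ :=
  Matrix.of fun ρ e => (if G.st e = ρ then 1 else 0) - (if G.ar e = ρ then 1 else 0) + 1

theorem shiftedIncidence_mulVec (v : E → ℝ) (ρ : V) :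
    (G.shiftedIncidence.mulVec v) ρ =
      ∑ e with G.st e = ρ, v e - ∑ e with G.ar e = ρ, v e + ∑ e, v e := by
  simp only [Matrix.mulVec, dotProduct, shiftedIncidence, Matrix.of_apply, add_mul, sub_mul,
    ite_mul, one_mul, zero_mul, Finset.sum_add_distrib, Finset.sum_sub_distrib, Finset.sum_filter]

variable [Fintype V]

theorem shiftedIncidence_mulVec_eq_zero_iff [Nonempty V] (v : E → ℝ) :
    G.shiftedIncidence.mulVec v = 0 ↔
      ∑ e, v e = 0 ∧ ∀ ρ : V, ∑ e with G.st e = ρ, v e = ∑ e with G.ar e = ρ, v e := by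
  constructor
  · intro h
    have h' : ∀ ρ, ∑ e with G.st e = ρ, v e - ∑ e with G.ar e = ρ, v e + ∑ e, v e = 0 :=
      fun ρ => by rw [← shiftedIncidence_mulVec, h, Pi.zero_apply]
    -- Summed over all vertices, inflow and outflow cancel, leaving the total mass times the number
    -- of vertices.
    have hs : ∑ e, v e = 0 := by
      have hsum := Finset.sum_eq_zero fun ρ (_ : ρ ∈ Finset.univ) => h' ρ
      rw [Finset.sum_add_distrib, Finset.sum_sub_distrib, Finset.sum_fiberwise,
        Finset.sum_fiberwise, sub_self, zero_add, Finset.sum_const, nsmul_eq_mul] at hsum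
      refine (mul_eq_zero.1 hsum).resolve_left ?_
      simp
    exact ⟨hs, fun ρ => by have := h' ρ; rw [hs] at this; linarith⟩
  · rintro ⟨hs, hf⟩
    funext ρ
    rw [shiftedIncidence_mulVec, hs, hf ρ]
    simp

/-- The rows are independent: the loop forces the coefficients of a relation to sum to zero, `hconn`
then makes them constant, hence zero. -/
theorem rank_shiftedIncidence {e₀ : E} (hloop : G.st e₀ = G.ar e₀)
    (hconn : ∀ h : V → ℝ, (∀ e, h (G.st e) = h (G.ar e)) → ∀ ρ ρ', h ρ = h ρ') :
    G.shiftedIncidence.rank = Fintype.card V := by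
  refine LinearIndependent.rank_matrix (Fintype.linearIndependent_iff.2 fun h hh ρ => ?_)
  have he : ∀ e, h (G.st e) - h (G.ar e) + ∑ ρ, h ρ = 0 := by
    intro e
    have := congrFun hh e
    simpa [Finset.sum_apply, shiftedIncidence, Matrix.row, mul_add, mul_sub,
      Finset.sum_add_distrib] using this
  have hS : ∑ ρ, h ρ = 0 := by
    have := he e₀
    rwa [hloop, sub_self, zero_add] at this
  have hc := hconn h fun e => by have := he e; rw [hS] at this; linarith
  rw [Finset.sum_congr rfl fun ρ' _ => hc ρ' ρ, Finset.sum_const, nsmul_eq_mul] at hS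
  have : Nonempty V := ⟨ρ⟩
  exact (mul_eq_zero.1 hS).resolve_left (by simp)

/-- From the strictly positive point `u`, a small step along any kernel vector keeps all weights
positive. -/
theorem direction_affineSpan_flowPolytope [Nonempty V] {u : E → ℝ} (hu : u ∈ G.flowPolytope)
    (hpos : ∀ e, 0 < u e) :
    (affineSpan ℝ G.flowPolytope).direction = LinearMap.ker G.shiftedIncidence.mulVecLin := by
  apply le_antisymm
  · rw [direction_affineSpan, vectorSpan_def, Submodule.span_le]
    rintro _ ⟨x, hx, y, hy, rfl⟩
    change G.shiftedIncidence.mulVec (x - y) = 0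
    rw [shiftedIncidence_mulVec_eq_zero_iff]
    refine ⟨?_, fun ρ => ?_⟩
    · simp [hx.2.1, hy.2.1]
    · simp only [Pi.sub_apply, Finset.sum_sub_distrib, hx.2.2, hy.2.2]
  · intro d hd
    obtain ⟨hs, hf⟩ := (shiftedIncidence_mulVec_eq_zero_iff G d).1 hd
    obtain ⟨t, ht0, ht⟩ : ∃ t : ℝ, 0 < t ∧ ∀ e, 0 < u e + t * d e := by
      have hev : ∀ᶠ t in 𝓝[>] (0 : ℝ), ∀ e, 0 < u e + t * d e := by
        rw [eventually_all]
        intro e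
        have hcont : Tendsto (fun t : ℝ => u e + t * d e) (𝓝 0) (𝓝 (u e + 0 * d e)) :=
          (continuous_const.add (continuous_id.mul continuous_const)).tendsto 0
        rw [zero_mul, add_zero] at hcont
        exact nhdsWithin_le_nhds (hcont.eventually (lt_mem_nhds (hpos e)))
      obtain ⟨t, h1, h2⟩ := (hev.and self_mem_nhdsWithin).exists
      exact ⟨t, h2, h1⟩
    have hmem : u + t • d ∈ G.flowPolytope := by
      refine mem_flowPolytope_of_nonneg (fun e => (ht e).le) ?_ fun ρ => ?_
      · simp [Finset.sum_add_distrib, ← Finset.mul_sum, hu.2.1, hs]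
      · simp [Finset.sum_add_distrib, ← Finset.mul_sum, hu.2.2, hf]
    have := AffineSubspace.vsub_mem_direction (subset_affineSpan ℝ _ hmem)
      (subset_affineSpan ℝ _ hu)
    rw [vsub_eq_sub, add_sub_cancel_left] at this
    exact (Submodule.smul_mem_iff _ ht0.ne').1 this

theorem finrank_direction_flowPolytope {u : E → ℝ} (hu : u ∈ G.flowPolytope)
    (hpos : ∀ e, 0 < u e) {e₀ : E} (hloop : G.st e₀ = G.ar e₀)
    (hconn : ∀ h : V → ℝ, (∀ e, h (G.st e) = h (G.ar e)) → ∀ ρ ρ', h ρ = h ρ') :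
    Fintype.card V + Module.finrank ℝ (affineSpan ℝ G.flowPolytope).direction =
      Fintype.card E := by
  have : Nonempty V := ⟨G.st e₀⟩
  have h := LinearMap.finrank_range_add_finrank_ker G.shiftedIncidence.mulVecLin
  rw [direction_affineSpan_flowPolytope G hu hpos, ← rank_shiftedIncidence G hloop hconn]
  rwa [Module.finrank_fintype_fun_eq_card] at h

end Dimension

end DiMultigraph

/-! ### Standardization and window patterns -/

theorem perm_eq_of_lt_iff_lt {n : ℕ} {σ τ : Equiv.Perm (Fin n)}
    (h : ∀ i j, σ i < σ j ↔ τ i < τ j) : σ = τ := by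
  -- `τ ∘ σ.symm` is an order automorphism of `Fin n`, and the identity is the only one.
  let iso : Fin n ≃o Fin n := StrictMono.orderIsoOfSurjective (τ ∘ σ.symm)
    (fun a b hab => (h (σ.symm a) (σ.symm b)).1 (by simpa using hab))
    (τ.surjective.comp σ.symm.surjective)
  ext i
  have hiso : iso (σ i) = σ i := by
    rw [Subsingleton.elim iso (OrderIso.refl (Fin n))]
    rfl
  have hiso' : iso (σ i) = τ i := congrArg τ (σ.symm_apply_apply i)
  rw [← hiso', hiso]

theorem std_eq_iff {α : Type*} [LinearOrder α] {n : ℕ} {x : Fin n → α}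
    (hx : Function.Injective x) {τ : Equiv.Perm (Fin n)} :
    std x = τ ↔ ∀ i j, x i < x j ↔ τ i < τ j :=
  ⟨fun h i j => by rw [← h, std_lt_std_iff hx],
    fun h => perm_eq_of_lt_iff_lt fun i j => by rw [std_lt_std_iff hx, h]⟩

theorem std_congr {α β : Type*} [LinearOrder α] [LinearOrder β] {n : ℕ} {x : Fin n → α}
    {y : Fin n → β} (hx : Function.Injective x) (hy : Function.Injective y)
    (h : ∀ i j, x i < x j ↔ y i < y j) : std x = std y :=
  (std_eq_iff hx).2 fun i j => by rw [h, std_lt_std_iff hy]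

theorem std_std_comp {α : Type*} [LinearOrder α] {m n : ℕ} {x : Fin n → α}
    (hx : Function.Injective x) {g : Fin m → Fin n} (hg : Function.Injective g) :
    std (fun j => std x (g j)) = std fun j => x (g j) :=
  std_congr ((std x).injective.comp hg) (hx.comp hg) fun _ _ => std_lt_std_iff hx _ _

/-- The pattern of the window of length `k` starting at position `i` of an infinite sequence. -/
def seqPattern {α : Type*} [LinearOrder α] (k : ℕ) (f : ℕ → α) (i : ℕ) : Equiv.Perm (Fin k) :=
  std fun j : Fin k => f (i + j)

theorem injective_window {α : Type*} {f : ℕ → α} {i N k : ℕ} (hf : Set.InjOn f (Set.Iio N)) (h : i + k ≤ N) :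
    Function.Injective fun j : Fin k => f (i + j) := fun a b hab => by
  have := hf (Set.mem_Iio.2 (by omega)) (Set.mem_Iio.2 (by omega)) hab
  exact Fin.ext (by omega)

section

variable {α : Type*} [LinearOrder α] {f : ℕ → α} {K i : ℕ}

theorem beginPattern_seqPattern (hf : Function.Injective fun j : Fin (K + 1) => f (i + j)) :
    (beginPattern (seqPattern (K + 1) f i) : Equiv.Perm (Fin K)) = seqPattern K f i :=
  std_std_comp (g := fun j : Fin K => (⟨j, by omega⟩ : Fin (K + 1))) hf
    fun a b h => Fin.ext (by simpa using h)

theorem endPattern_seqPattern (hf : Function.Injective fun j : Fin (K + 1) => f (i + j)) :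
    (endPattern (seqPattern (K + 1) f i) : Equiv.Perm (Fin K)) = seqPattern K f (i + 1) := by
  refine (std_std_comp (g := fun j : Fin K => (⟨j + 1, by omega⟩ : Fin (K + 1))) hf
    fun a b h => Fin.ext (by simpa using h)).trans ?_
  simp only [seqPattern, add_assoc, add_comm 1]

end

/-- A window of length `K + 1` fits exactly when it starts before `n - K`; truncated subtraction
gives no window when `n ≤ K`. -/
theorem consecOcc_eq_count {α : Type*} [LinearOrder α] {n K : ℕ} {σ : Equiv.Perm (Fin n)}
    {f : ℕ → α} (hf : ∀ i (h : i + (K + 1) ≤ n), windowPattern σ i h = seqPattern (K + 1) f i)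
    (π : Equiv.Perm (Fin (K + 1))) :
    consecOcc π σ = Nat.count (fun i => seqPattern (K + 1) f i = π) (n - K) := by
  rw [Nat.count_eq_card_filter_range, consecOcc]
  congr 1
  ext i
  simp only [Finset.mem_filter, Finset.mem_range]
  constructor
  · rintro ⟨_, h, hw⟩
    exact ⟨by omega, by rw [← hf i h, hw]⟩
  · rintro ⟨h, hw⟩
    exact ⟨by omega, by omega, by rw [hf i, hw]⟩

/-- Two predicates that agree except at the last `K` places have close counts. -/
theorem count_le_count_add {p q : ℕ → Prop} [DecidablePred p] [DecidablePred q] {n K : ℕ}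
    (h : ∀ i, i + K < n → p i → q i) : Nat.count p n ≤ Nat.count q n + K := by
  calc Nat.count p n ≤ Nat.count p (n - K) + K := by
        calc Nat.count p n ≤ Nat.count p (n - K + K) := Nat.count_monotone p (by omega)
          _ ≤ _ := by rw [Nat.count_add]; exact Nat.add_le_add_left (Nat.count_le _) _
    _ ≤ Nat.count q (n - K) + K := by
        gcongr 1
        rw [Nat.count_eq_card_filter_range, Nat.count_eq_card_filter_range]
        refine Finset.card_le_card fun i hi => ?_
        simp only [Finset.mem_filter, Finset.mem_range] at hi ⊢
        exact ⟨hi.1, h i (by omega) hi.2⟩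
    _ ≤ Nat.count q n + K := by
        gcongr 1
        exact Nat.count_monotone q (by omega)

/-! ### Limits of proportions are circulations -/

section Feasible

variable {K : ℕ}

/-- An extension of a permutation of `Fin n` to a sequence. -/
def extendPerm {n : ℕ} (σ : Equiv.Perm (Fin n)) (i : ℕ) : ℕ :=
  if h : i < n then σ ⟨i, h⟩ else i

theorem extendPerm_injective {n : ℕ} (σ : Equiv.Perm (Fin n)) :
    Function.Injective (extendPerm σ) := by
  intro a b h
  unfold extendPerm at h
  split_ifs at h with ha hb hb
  · simpa using σ.injective (Fin.ext h)
  · have := (σ ⟨a, ha⟩).2; omega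
  · have := (σ ⟨b, hb⟩).2; omega
  · exact h

theorem windowPattern_eq_seqPattern {n k : ℕ} (σ : Equiv.Perm (Fin n)) (i : ℕ) (h : i + k ≤ n) :
    windowPattern σ i h = seqPattern k (extendPerm σ) i := by
  refine std_congr (fun a b hab => ?_)
    (injective_window (N := i + k) (extendPerm_injective σ).injOn le_rfl) fun a b => ?_
  · have := σ.injective hab
    simp only [Fin.mk.injEq] at this
    exact Fin.ext (by omega)
  · have ha : i + a < n := by omega
    have hb : i + b < n := by omega
    simp [extendPerm, ha, hb]

theorem sum_filter_count_seq {β γ : Type*} [Fintype β] [DecidableEq β] [DecidableEq γ]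
    (p : ℕ → β) (g : β → γ) (c : γ) (n : ℕ) :
    ∑ b with g b = c, Nat.count (fun i => p i = b) n = Nat.count (fun i => g (p i) = c) n := by
  induction n with
  | zero => simp
  | succ n ih =>
    simp only [Nat.count_succ, Finset.sum_add_distrib, ih, Finset.sum_ite_eq,
      Finset.mem_filter, Finset.mem_univ, true_and]

theorem sum_count_seq {β : Type*} [Fintype β] [DecidableEq β] (p : ℕ → β) (n : ℕ) :
    ∑ b, Nat.count (fun i => p i = b) n = n := by
  have := sum_filter_count_seq p (fun _ => ()) () n
  simpa [Nat.count_true] using this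

theorem sum_consecOcc {n : ℕ} (σ : Equiv.Perm (Fin n)) :
    ∑ π : Equiv.Perm (Fin (K + 1)), consecOcc π σ = n - K := by
  rw [Finset.sum_congr rfl fun π _ =>
    consecOcc_eq_count (fun i h => windowPattern_eq_seqPattern σ i h) π, sum_count_seq]

/-- Outflow at `ρ` counts `K`-windows at `i`, inflow those at `i + 1`; the two counts differ only
through the end windows. -/
theorem sum_beginPattern_consecOcc {n : ℕ} (σ : Equiv.Perm (Fin n)) (ρ : Equiv.Perm (Fin K)) :
    ∑ π : Equiv.Perm (Fin (K + 1)) with beginPattern (k := K + 1) π = ρ, consecOcc π σ =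
      Nat.count (fun i => seqPattern K (extendPerm σ) i = ρ) (n - K) := by
  rw [Finset.sum_congr rfl fun π _ =>
    consecOcc_eq_count (fun i h => windowPattern_eq_seqPattern σ i h) π]
  refine (sum_filter_count_seq _ (beginPattern (k := K + 1)) ρ _).trans ?_
  simp only [beginPattern_seqPattern
    (injective_window (N := _ + (K + 1)) (extendPerm_injective σ).injOn le_rfl)]

theorem sum_endPattern_consecOcc {n : ℕ} (σ : Equiv.Perm (Fin n)) (ρ : Equiv.Perm (Fin K)) :
    ∑ π : Equiv.Perm (Fin (K + 1)) with endPattern (k := K + 1) π = ρ, consecOcc π σ =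
      Nat.count (fun i => seqPattern K (extendPerm σ) (i + 1) = ρ) (n - K) := by
  rw [Finset.sum_congr rfl fun π _ =>
    consecOcc_eq_count (fun i h => windowPattern_eq_seqPattern σ i h) π]
  refine (sum_filter_count_seq _ (endPattern (k := K + 1)) ρ _).trans ?_
  simp only [endPattern_seqPattern
    (injective_window (N := _ + (K + 1)) (extendPerm_injective σ).injOn le_rfl)]

theorem abs_count_sub_count_succ_le (p : ℕ → Prop) [DecidablePred p] (n : ℕ) :
    |(Nat.count p n : ℝ) - Nat.count (fun i => p (i + 1)) n| ≤ 1 := by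
  have h := Nat.count_succ' p n
  rw [Nat.count_succ] at h
  have h' : (Nat.count p n : ℤ) - Nat.count (fun i => p (i + 1)) n ≤ 1 ∧
      -1 ≤ (Nat.count p n : ℤ) - Nat.count (fun i => p (i + 1)) n := by
    split_ifs at h <;> omega
  rw [abs_le]
  exact ⟨by exact_mod_cast h'.2, by exact_mod_cast h'.1⟩

/-- A quantity of bounded distance from a multiple of `n` has the expected proportion. -/
theorem tendsto_div_of_abs_sub_le {a : ℕ → ℝ} {n : ℕ → ℕ} (hn : Tendsto n atTop atTop)
    {v C : ℝ} (h : ∀ m, |a m - n m * v| ≤ C) :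
    Tendsto (fun m => a m / n m) atTop (𝓝 v) := by
  have hn' : Tendsto (fun m => (n m : ℝ)) atTop atTop := tendsto_natCast_atTop_atTop.comp hn
  have h0 : Tendsto (fun m => C / (n m : ℝ)) atTop (𝓝 0) := hn'.const_div_atTop C
  rw [tendsto_iff_norm_sub_tendsto_zero]
  refine squeeze_zero' (Eventually.of_forall fun _ => norm_nonneg _) ?_ h0
  filter_upwards [hn'.eventually_gt_atTop 0] with m hm
  rw [Real.norm_eq_abs, le_div_iff₀ hm]
  calc |a m / n m - v| * n m = |a m / n m - v| * |(n m : ℝ)| := by rw [abs_of_pos hm]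
    _ = |a m - n m * v| := by rw [← abs_mul]; congr 1; field_simp
    _ ≤ C := h m

theorem feasibleRegion_subset :
    feasibleRegion (K + 1) ⊆ {v | (∀ π, v π ∈ Set.Icc (0 : ℝ) 1) ∧ ∑ π, v π = 1 ∧
      ∀ ρ : Equiv.Perm (Fin K),
        ∑ π : Equiv.Perm (Fin (K + 1)) with beginPattern (k := K + 1) π = ρ, v π =
          ∑ π : Equiv.Perm (Fin (K + 1)) with endPattern (k := K + 1) π = ρ, v π} := by
  rintro v ⟨h01, σ, hσ, hlim⟩
  refine ⟨h01, ?_, fun ρ => ?_⟩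
  · have h1 : Tendsto (fun m => ∑ π : Equiv.Perm (Fin (K + 1)), consecProp π (σ m).2) atTop
        (𝓝 (∑ π, v π)) := tendsto_finsetSum _ fun π _ => hlim π
    refine tendsto_nhds_unique h1 ?_
    simp only [consecProp, ← Finset.sum_div, ← Nat.cast_sum, sum_consecOcc]
    refine tendsto_div_of_abs_sub_le (C := K) hσ fun m => ?_
    rw [mul_one, abs_le]
    have h2 : ((σ m).1 : ℝ) ≤ ((σ m).1 - K : ℕ) + K := by exact_mod_cast (by omega)
    have h3 : (((σ m).1 - K : ℕ) : ℝ) ≤ (σ m).1 := by exact_mod_cast (by omega)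
    have h4 : (0 : ℝ) ≤ K := by positivity
    constructor <;> linarith
  · have h1 : Tendsto (fun m => ∑ π : Equiv.Perm (Fin (K + 1)) with beginPattern (k := K + 1) π = ρ,
        consecProp π (σ m).2 - ∑ π : Equiv.Perm (Fin (K + 1)) with endPattern (k := K + 1) π = ρ,
        consecProp π (σ m).2) atTop
        (𝓝 (∑ π : Equiv.Perm (Fin (K + 1)) with beginPattern (k := K + 1) π = ρ, v π -
          ∑ π : Equiv.Perm (Fin (K + 1)) with endPattern (k := K + 1) π = ρ, v π)) :=
      (tendsto_finsetSum _ fun π _ => hlim π).sub (tendsto_finsetSum _ fun π _ => hlim π)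
    refine sub_eq_zero.1 (tendsto_nhds_unique h1 ?_)
    simp only [consecProp, ← Finset.sum_div, ← Nat.cast_sum, ← sub_div]
    refine tendsto_div_of_abs_sub_le (C := 1) hσ fun m => ?_
    rw [mul_zero, sub_zero, sum_beginPattern_consecOcc, sum_endPattern_consecOcc]
    exact abs_count_sub_count_succ_le _ _

end Feasible

/-! ### Realizing walks by sequences of distinct rationals -/

section Realization

variable {K : ℕ}

/-- A new value can be inserted between two families of values, avoiding finitely many values. -/
theorem exists_between_not_mem {α : Type*} [LinearOrder α] [DenselyOrdered α] [NoMinOrder α]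
    [NoMaxOrder α] [Nonempty α] (F lo hi : Finset α) (hlo : lo ⊆ F) (hhi : hi ⊆ F)
    (h : ∀ x ∈ lo, ∀ y ∈ hi, x < y) :
    ∃ m, m ∉ F ∧ (∀ x ∈ lo, x < m) ∧ ∀ y ∈ hi, m < y := by
  obtain ⟨m, hm1, hm2⟩ := Order.exists_between_finsets lo hi h
  -- The separating value `m` may lie in `F`; cutting all of `F` at `m` and interpolating again
  -- avoids it.
  obtain ⟨m', h1, h2⟩ := Order.exists_between_finsets {x ∈ F | x ≤ m} {x ∈ F | m < x}
    fun x hx y hy => (Finset.mem_filter.1 hx).2.trans_lt (Finset.mem_filter.1 hy).2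
  refine ⟨m', fun hF => ?_, fun x hx => h1 x (Finset.mem_filter.2 ⟨hlo hx, (hm1 x hx).le⟩),
    fun y hy => h2 y (Finset.mem_filter.2 ⟨hhi hy, hm2 y hy⟩)⟩
  rcases le_or_gt m' m with hle | hlt
  · exact lt_irrefl _ (h1 m' (Finset.mem_filter.2 ⟨hF, hle⟩))
  · exact lt_irrefl _ (h2 m' (Finset.mem_filter.2 ⟨hF, hlt⟩))

theorem seqPattern_congr {α : Type*} [LinearOrder α] {k i i' : ℕ} {f g : ℕ → α}
    (h : ∀ j < k, f (i + j) = g (i' + j)) : seqPattern k f i = seqPattern k g i' := by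
  unfold seqPattern
  congr 1
  funext j
  exact h j j.2

/-- A sequence whose last `K` entries have pattern `beginPattern π` can be continued by one entry
so that the last `K + 1` entries have pattern `π`. -/
theorem exists_extension {n : ℕ} {f : ℕ → ℚ} (hf : Set.InjOn f (Set.Iio (n + K)))
    {π : Equiv.Perm (Fin (K + 1))} (hπ : seqPattern K f n = beginPattern π) :
    ∃ g : ℕ → ℚ, Set.InjOn g (Set.Iio (n + 1 + K)) ∧ (∀ i < n + K, g i = f i) ∧
      seqPattern (K + 1) g n = π := by
  have hcmp : ∀ a b : Fin K, f (n + a) < f (n + b) ↔ π a.castSucc < π b.castSucc := by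
    intro a b
    rw [← std_lt_std_iff (injective_window hf le_rfl) a b]
    change seqPattern K f n a < seqPattern K f n b ↔ _
    rw [hπ]
    exact std_lt_std_iff (x := fun j : Fin K => π j.castSucc)
      (π.injective.comp (Fin.castSucc_injective K)) a b
  have hmem : ∀ p : Fin K → Prop, ∀ [DecidablePred p],
      ({j | p j} : Finset (Fin K)).image (fun j : Fin K => f (n + j)) ⊆
        (Finset.range (n + K)).image f := by
    intro p _ x hx
    obtain ⟨j, _, rfl⟩ := Finset.mem_image.1 hx
    exact Finset.mem_image.2 ⟨n + j, Finset.mem_range.2 (by omega), rfl⟩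
  obtain ⟨y, hyF, hylo, hyhi⟩ := exists_between_not_mem ((Finset.range (n + K)).image f)
    (({j | π j.castSucc < π (Fin.last K)} : Finset (Fin K)).image fun j : Fin K => f (n + j))
    (({j | π (Fin.last K) < π j.castSucc} : Finset (Fin K)).image fun j : Fin K => f (n + j))
    (hmem _) (hmem _) (by
      intro x hx z hz
      obtain ⟨a, ha, rfl⟩ := Finset.mem_image.1 hx
      obtain ⟨b, hb, rfl⟩ := Finset.mem_image.1 hz
      exact (hcmp a b).2 ((Finset.mem_filter.1 ha).2.trans (Finset.mem_filter.1 hb).2))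
  have hyne : ∀ i < n + K, f i ≠ y := fun i hi h =>
    hyF (Finset.mem_image.2 ⟨i, Finset.mem_range.2 hi, h⟩)
  have hlt1 : ∀ a : Fin K, π a.castSucc < π (Fin.last K) → f (n + a) < y := fun a ha =>
    hylo _ (Finset.mem_image.2 ⟨a, by simpa using ha, rfl⟩)
  have hlt2 : ∀ a : Fin K, π (Fin.last K) < π a.castSucc → y < f (n + a) := fun a ha =>
    hyhi _ (Finset.mem_image.2 ⟨a, by simpa using ha, rfl⟩)
  have hne : ∀ a : Fin K, π a.castSucc ≠ π (Fin.last K) := fun a h =>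
    (Fin.castSucc_lt_last a).ne (π.injective h)
  have hgf : ∀ i < n + K, Function.update f (n + K) y i = f i := fun i hi =>
    Function.update_of_ne hi.ne _ _
  have hinj : Set.InjOn (Function.update f (n + K) y) (Set.Iio (n + 1 + K)) := by
    intro a ha b hb hab
    have ha : a < n + 1 + K := ha
    have hb : b < n + 1 + K := hb
    rcases (by omega : a < n + K ∨ a = n + K) with ha | rfl <;>
      rcases (by omega : b < n + K ∨ b = n + K) with hb | rfl
    · rw [hgf a ha, hgf b hb] at hab
      exact hf ha hb hab
    · rw [hgf a ha, Function.update_self] at hab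
      exact absurd hab (hyne a ha)
    · rw [hgf b hb, Function.update_self] at hab
      exact absurd hab.symm (hyne b hb)
    · rfl
  refine ⟨Function.update f (n + K) y, hinj, hgf,
    (std_eq_iff (injective_window hinj (by omega))).2 fun a b => ?_⟩
  have hlast : Function.update f (n + K) y (n + (Fin.last K : Fin (K + 1))) = y := by simp
  have hcast : ∀ a : Fin K,
      Function.update f (n + K) y (n + (a.castSucc : Fin (K + 1))) = f (n + a) := fun a => by
    rw [Fin.val_castSucc]
    exact hgf _ (by omega)
  induction a using Fin.lastCases with
  | last =>
    induction b using Fin.lastCases with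
    | last => simp
    | cast b =>
      rw [hlast, hcast]
      rcases lt_or_gt_of_ne (hne b) with h | h
      · exact iff_of_false (hlt1 b h).not_gt h.not_gt
      · exact iff_of_true (hlt2 b h) h
  | cast a =>
    induction b using Fin.lastCases with
    | last =>
      rw [hlast, hcast]
      rcases lt_or_gt_of_ne (hne a) with h | h
      · exact iff_of_true (hlt1 a h) h
      · exact iff_of_false (hlt2 a h).not_gt h.not_gt
    | cast b => rw [hcast, hcast, hcmp]

/-- Every walk of the overlap graph is the sequence of patterns of a sequence. -/
theorem exists_seq_of_walk {p : ℕ → Equiv.Perm (Fin (K + 1))}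
    (hp : ∀ i, endPattern (p i) = beginPattern (p (i + 1))) (n : ℕ) :
    ∃ f : ℕ → ℚ, Set.InjOn f (Set.Iio (n + K)) ∧ (∀ i < n, seqPattern (K + 1) f i = p i) ∧
      seqPattern K f n = beginPattern (p n) := by
  induction n with
  | zero =>
    -- The default `0` lies beyond the `K` entries on which injectivity and the pattern are tested.
    have hval : ∀ j (h : j < K), (if h : j < K then
        ((p 0 (Fin.castSucc ⟨j, h⟩) : ℕ) : ℚ) else 0) = (p 0 (Fin.castSucc ⟨j, h⟩) : ℕ) :=
      fun j h => dif_pos h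
    have hinj : Set.InjOn (fun j => if h : j < K then
        ((p 0 (Fin.castSucc ⟨j, h⟩) : ℕ) : ℚ) else 0) (Set.Iio (0 + K)) := by
      intro a ha b hb hab
      have ha : a < K := by simpa using ha
      have hb : b < K := by simpa using hb
      simp only [hval a ha, hval b hb, Nat.cast_inj] at hab
      simpa using (p 0).injective (Fin.ext hab)
    refine ⟨_, hinj, fun i hi => absurd hi (Nat.not_lt_zero i), ?_⟩
    refine std_congr (injective_window hinj le_rfl)
      ((p 0).injective.comp (Fin.castSucc_injective K)) fun a b => ?_
    simp only [zero_add, hval _ a.2, hval _ b.2, Nat.cast_lt]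
    rfl
  | succ n ih =>
    obtain ⟨f, hf, hpat, hbeg⟩ := ih
    obtain ⟨g, hg, hgf, hgp⟩ := exists_extension hf hbeg
    refine ⟨g, hg, fun i hi => ?_, ?_⟩
    · rcases (by omega : i < n ∨ i = n) with hi | rfl
      · rw [← hpat i hi]
        exact seqPattern_congr fun j hj => hgf _ (by omega)
      · exact hgp
    · rw [← hp n, ← hgp]
      exact (endPattern_seqPattern (injective_window hg (by omega))).symm

/-- The first `n₁` entries of a sequence can be followed by entries above them that are in the
same relative order as those of a second sequence. -/
theorem exists_concat (f₁ f₂ : ℕ → ℚ) {n₁ N : ℕ} (h₁ : Set.InjOn f₁ (Set.Iio n₁))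
    (h₂ : Set.InjOn f₂ (Set.Iio N)) :
    ∃ f : ℕ → ℚ, Set.InjOn f (Set.Iio (n₁ + N)) ∧ (∀ i < n₁, f i = f₁ i) ∧
      ∀ k i, i + k ≤ N → seqPattern k f (n₁ + i) = seqPattern k f₂ i := by
  obtain ⟨A, hA⟩ := ((Finset.range n₁).image f₁).bddAbove
  obtain ⟨B, hB⟩ := ((Finset.range N).image f₂).bddBelow
  have hA' : ∀ i < n₁, f₁ i ≤ A := fun i hi =>
    hA (Finset.mem_image_of_mem _ (Finset.mem_range.2 hi))
  have hB' : ∀ i < N, B ≤ f₂ i := fun i hi =>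
    hB (Finset.mem_image_of_mem _ (Finset.mem_range.2 hi))
  -- The shift lifts the lower bound `B` to `A + 1`, strictly above the first block.
  obtain ⟨f, hf⟩ : ∃ f : ℕ → ℚ, f = fun i => if i < n₁ then f₁ i else f₂ (i - n₁) + (A - B + 1) :=
    ⟨_, rfl⟩
  have hlo : ∀ i < n₁, f i = f₁ i := fun i hi => by rw [hf]; exact if_pos hi
  have hhi : ∀ i, f (n₁ + i) = f₂ i + (A - B + 1) := fun i => by
    rw [hf]
    simp
  have hinj : Set.InjOn f (Set.Iio (n₁ + N)) := by
    intro a ha b hb hab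
    have ha : a < n₁ + N := ha
    have hb : b < n₁ + N := hb
    rcases lt_or_ge a n₁ with ha' | ha' <;> rcases lt_or_ge b n₁ with hb' | hb'
    · rw [hlo a ha', hlo b hb'] at hab
      exact h₁ ha' hb' hab
    · obtain ⟨c, rfl⟩ := Nat.exists_eq_add_of_le hb'
      rw [hlo a ha', hhi] at hab
      have := hA' a ha'
      have := hB' c (by omega)
      linarith
    · obtain ⟨c, rfl⟩ := Nat.exists_eq_add_of_le ha'
      rw [hlo b hb', hhi] at hab
      have := hA' b hb'
      have := hB' c (by omega)
      linarith
    · obtain ⟨c, rfl⟩ := Nat.exists_eq_add_of_le ha'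
      obtain ⟨d, rfl⟩ := Nat.exists_eq_add_of_le hb'
      rw [hhi, hhi] at hab
      rw [h₂ (Set.mem_Iio.2 (by omega)) (Set.mem_Iio.2 (by omega)) (add_right_cancel hab)]
  refine ⟨f, hinj, hlo, fun k i hi => ?_⟩
  refine std_congr (injective_window hinj (by omega)) (injective_window h₂ hi) fun a b => ?_
  simp only [add_assoc, hhi, add_lt_add_iff_right]

end Realization

/-! ### Approximation with bounded error -/

section Approximable

variable {K : ℕ}

/-- The vectors that are approximated by the pattern counts of sequences with bounded error. -/
def approximable (K : ℕ) : Set (Equiv.Perm (Fin (K + 1)) → ℝ) :=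
  {v | ∃ C : ℝ, ∀ n : ℕ, ∃ f : ℕ → ℚ, Set.InjOn f (Set.Iio (n + K)) ∧
    ∀ π, |(Nat.count (fun i => seqPattern (K + 1) f i = π) n : ℝ) - n * v π| ≤ C}

theorem abs_count_sub_count_le {p q : ℕ → Prop} [DecidablePred p] [DecidablePred q] {n K : ℕ}
    (h : ∀ i, i + K < n → (p i ↔ q i)) : |(Nat.count p n : ℝ) - Nat.count q n| ≤ K := by
  have h1 : (Nat.count p n : ℝ) ≤ Nat.count q n + K := by
    exact_mod_cast count_le_count_add fun i hi => (h i hi).1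
  have h2 : (Nat.count q n : ℝ) ≤ Nat.count p n + K := by
    exact_mod_cast count_le_count_add fun i hi => (h i hi).2
  rw [abs_le]
  constructor <;> linarith

/-- Standardizing the first `m` entries preserves window patterns and loses at most `K` windows,
those running past position `m`. -/
theorem mem_feasibleRegion_of_approximable {v : Equiv.Perm (Fin (K + 1)) → ℝ}
    (h01 : ∀ π, v π ∈ Set.Icc (0 : ℝ) 1) (hv : v ∈ approximable K) :
    v ∈ feasibleRegion (K + 1) := by
  obtain ⟨C, hC⟩ := hv
  choose f hf hcount using hC
  refine ⟨h01, fun m => ⟨m, std fun i : Fin m => f m i⟩, tendsto_id, fun π => ?_⟩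
  refine tendsto_div_of_abs_sub_le (C := K + C) tendsto_id fun m => ?_
  have hinj : Function.Injective fun i : Fin m => f m i := fun a b hab =>
    Fin.ext (hf m (Set.mem_Iio.2 (by omega)) (Set.mem_Iio.2 (by omega)) hab)
  have hocc : consecOcc π (std fun i : Fin m => f m i) =
      Nat.count (fun i => seqPattern (K + 1) (f m) i = π) (m - K) :=
    consecOcc_eq_count (fun i h => std_std_comp
      (g := fun j : Fin (K + 1) => (⟨i + j, by omega⟩ : Fin m)) hinj
      fun a b hab => Fin.ext (by simpa using hab)) π
  have h1 : |(consecOcc π (std fun i : Fin m => f m i) : ℝ) -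
      Nat.count (fun i => seqPattern (K + 1) (f m) i = π) m| ≤ K := by
    rw [hocc]
    have ha := Nat.count_monotone (fun i => seqPattern (K + 1) (f m) i = π)
      (by omega : m - K ≤ m)
    have hb := Nat.count_monotone (fun i => seqPattern (K + 1) (f m) i = π)
      (by omega : m ≤ m - K + K)
    rw [Nat.count_add] at hb
    have hc := hb.trans (Nat.add_le_add_left (Nat.count_le _) _)
    have ha' : (Nat.count (fun i => seqPattern (K + 1) (f m) i = π) (m - K) : ℝ) ≤
      Nat.count (fun i => seqPattern (K + 1) (f m) i = π) m := by exact_mod_cast ha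
    have hc' : (Nat.count (fun i => seqPattern (K + 1) (f m) i = π) m : ℝ) ≤
      Nat.count (fun i => seqPattern (K + 1) (f m) i = π) (m - K) + K := by exact_mod_cast hc
    have : (0 : ℝ) ≤ K := by positivity
    rw [abs_le]
    constructor <;> linarith
  have h2 := hcount m π
  exact (abs_sub_le _ _ _).trans (add_le_add h1 h2)

/-- Concatenate about `a * n` entries for `v` with the rest for `w`. The errors from both sequences,
the junction and the rounding are all bounded independently of `n`. -/
theorem convex_approximable : Convex ℝ (approximable K) := by
  rintro v ⟨C₁, h₁⟩ w ⟨C₂, h₂⟩ a b ha hb hab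
  refine ⟨K + C₁ + C₂ + ∑ π, |v π - w π|, fun n => ?_⟩
  obtain ⟨n₁, hn₁, hn₁'⟩ : ∃ n₁ : ℕ, n₁ ≤ n ∧ |(n₁ : ℝ) - a * n| ≤ 1 := by
    have h0 : 0 ≤ a * n := by positivity
    have h1 : a * n ≤ n := mul_le_of_le_one_left (by positivity) (by linarith)
    refine ⟨⌊a * n⌋₊, Nat.floor_le_of_le h1, ?_⟩
    have := Nat.floor_le h0
    have := Nat.lt_floor_add_one (a * n)
    rw [abs_le]
    constructor <;> linarith
  obtain ⟨n₂, rfl⟩ := Nat.exists_eq_add_of_le hn₁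
  obtain ⟨f₁, hf₁, hc₁⟩ := h₁ n₁
  obtain ⟨f₂, hf₂, hc₂⟩ := h₂ n₂
  obtain ⟨f, hf, hlo, hhi⟩ := exists_concat f₁ f₂
    (hf₁.mono (Set.Iio_subset_Iio (by omega) : Set.Iio n₁ ⊆ _)) hf₂
  refine ⟨f, by rwa [add_assoc], fun π => ?_⟩
  -- At most `K` windows starting in the first block reach past it.
  have e₁ : |(Nat.count (fun i => seqPattern (K + 1) f i = π) n₁ : ℝ) -
      Nat.count (fun i => seqPattern (K + 1) f₁ i = π) n₁| ≤ K := by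
    refine abs_count_sub_count_le fun i hi => ?_
    rw [seqPattern_congr (f := f) (g := f₁) (i' := i) fun j hj => hlo _ (by omega)]
  have e₂ : Nat.count (fun i => seqPattern (K + 1) f (n₁ + i) = π) n₂ =
      Nat.count (fun i => seqPattern (K + 1) f₂ i = π) n₂ := by
    rw [Nat.count_eq_card_filter_range, Nat.count_eq_card_filter_range]
    congr 1
    refine Finset.filter_congr fun i hi => ?_
    rw [hhi (K + 1) i (by have := Finset.mem_range.1 hi; omega)]
  -- Rounding error: `n₁ v + n₂ w` differs from `n (a v + (1 - a) w)` by `(n₁ - a n)(v - w)`.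
  have e₃ : |((n₁ : ℝ) - a * (n₁ + n₂ : ℕ)) * (v π - w π)| ≤ ∑ π, |v π - w π| := by
    rw [abs_mul]
    calc _ ≤ 1 * |v π - w π| := by gcongr
      _ = |v π - w π| := one_mul _
      _ ≤ _ := Finset.single_le_sum (f := fun π => |v π - w π|) (fun _ _ => abs_nonneg _)
        (Finset.mem_univ π)
  rw [Nat.count_add, e₂]
  obtain rfl : b = 1 - a := by linarith
  have d₁ := abs_le.1 e₁
  have d₂ := abs_le.1 (hc₁ π)
  have d₃ := abs_le.1 (hc₂ π)
  have d₄ := abs_le.1 e₃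
  push_cast at d₄ ⊢
  simp only [Pi.add_apply, Pi.smul_apply, smul_eq_mul]
  rw [abs_le]
  constructor <;> nlinarith

/-- Removing a full period does not change the discrepancy, so only `n < L` matters. -/
theorem abs_count_sub_le_of_periodic {p : ℕ → Prop} [DecidablePred p] {L : ℕ} (hL : 0 < L)
    (hp : ∀ i, p (L + i) ↔ p i) (n : ℕ) :
    |(Nat.count p n : ℝ) - n * ((Nat.count p L : ℝ) / L)| ≤ L := by
  have hL' : (0 : ℝ) < L := by exact_mod_cast hL
  induction n using Nat.strong_induction_on with
  | _ n ih =>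
    rcases lt_or_ge n L with h | h
    · have h1 : (Nat.count p n : ℝ) ≤ n := by exact_mod_cast Nat.count_le p
      have h2 : (Nat.count p L : ℝ) / L ≤ 1 := by
        rw [div_le_one hL']
        exact_mod_cast Nat.count_le p
      have h3 : (0 : ℝ) ≤ (Nat.count p L : ℝ) / L := by positivity
      have h4 : (n : ℝ) ≤ L := by exact_mod_cast h.le
      have h5 : (0 : ℝ) ≤ n := by positivity
      have h6 : (0 : ℝ) ≤ Nat.count p n := by positivity
      have h7 := mul_le_mul_of_nonneg_left h2 h5
      have h8 := mul_nonneg h5 h3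
      rw [abs_le]
      constructor <;> linarith
    · obtain ⟨m, rfl⟩ := Nat.exists_eq_add_of_le h
      have h1 := ih m (by omega)
      rw [Nat.count_add]
      simp only [hp]
      have : ((Nat.count p L + Nat.count p m : ℕ) : ℝ) -
          ((L + m : ℕ) : ℝ) * ((Nat.count p L : ℝ) / L) =
          Nat.count p m - m * ((Nat.count p L : ℝ) / L) := by
        push_cast
        field_simp
        ring
      rwa [this]

theorem count_getElem_mod {E : Type*} [DecidableEq E] {C : List E} (hC : 0 < C.length) (e : E) :
    Nat.count (fun i => C[i % C.length]'(Nat.mod_lt _ hC) = e) C.length = C.count e := by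
  have hC' : C = (List.range C.length).map fun i => C[i % C.length]'(Nat.mod_lt _ hC) := by
    refine List.ext_getElem (by simp) fun i h _ => ?_
    simp [Nat.mod_eq_of_lt h]
  conv_rhs => rw [hC']
  rw [List.count, List.countP_map, Nat.count]
  congr 1

theorem DiMultigraph.IsCycle.ar_getElem_mod {V E : Type*} {G : DiMultigraph V E} {C : List E}
    (h : G.IsCycle C) (hC : 0 < C.length) (i : ℕ) :
    G.ar (C[i % C.length]'(Nat.mod_lt _ hC)) = G.st (C[(i + 1) % C.length]'(Nat.mod_lt _ hC)) := by
  obtain ⟨hw, hne, hc⟩ := h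
  have hi := Nat.mod_lt i hC
  rcases (by omega : i % C.length + 1 < C.length ∨ i % C.length + 1 = C.length) with hlt | heq
  · have hm : (i + 1) % C.length = i % C.length + 1 := by
      rw [Nat.add_mod, Nat.mod_eq_of_lt (by omega : 1 < C.length), Nat.mod_eq_of_lt hlt]
    simp only [hm]
    exact hw.getElem _ hlt
  · have hm : (i + 1) % C.length = 0 := by
      rw [← Nat.mod_add_mod, heq, Nat.mod_self]
    have hm' : i % C.length = C.length - 1 := by omega
    simp only [hm, hm']
    rw [List.head_eq_getElem, List.getLast_eq_getElem] at hc
    exact hc.symm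

theorem cycleVector_mem_approximable {C : List (Equiv.Perm (Fin (K + 1)))}
    (h : (overlapGraph (K + 1)).IsCycle C) : cycleVector C ∈ approximable K := by
  have hC : 0 < C.length := List.length_pos_of_ne_nil h.2.choose
  refine ⟨C.length, fun n => ?_⟩
  obtain ⟨f, hf, hpat, _⟩ := exists_seq_of_walk (fun i => h.ar_getElem_mod hC i) n
  refine ⟨f, hf, fun π => ?_⟩
  have hcount : Nat.count (fun i => seqPattern (K + 1) f i = π) n =
      Nat.count (fun i => C[i % C.length]'(Nat.mod_lt _ hC) = π) n := by
    rw [Nat.count_eq_card_filter_range, Nat.count_eq_card_filter_range]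
    congr 1
    refine Finset.filter_congr fun i hi => ?_
    rw [hpat i (Finset.mem_range.1 hi)]
  rw [hcount, cycleVector, ← count_getElem_mod hC π]
  exact abs_count_sub_le_of_periodic hC (fun i => by simp) n

end Approximable

/-! ### Properties of the overlap graph -/

section OverlapGraph

variable {K : ℕ}

theorem feasibleRegion_eq_flowPolytope :
    feasibleRegion (K + 1) = (overlapGraph (K + 1)).flowPolytope := by
  refine Set.Subset.antisymm feasibleRegion_subset fun v hv => ?_
  refine mem_feasibleRegion_of_approximable hv.1 ?_
  rw [DiMultigraph.flowPolytope_eq_cyclePolytope] at hv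
  refine convexHull_min ?_ convex_approximable hv
  rintro _ ⟨C, hC, rfl⟩
  exact cycleVector_mem_approximable hC.1

theorem beginPattern_one_eq_endPattern_one :
    beginPattern (1 : Equiv.Perm (Fin (K + 1))) = endPattern 1 :=
  std_congr (fun a b h => by simpa [Fin.ext_iff] using h) (fun a b h => by
    simpa [Fin.ext_iff] using h) fun a b => by simp

/-- Moving the last entry to the front is a bijection from edges leaving `ρ` to edges entering `ρ`;
hence the uniform vector is a circulation. -/
theorem endPattern_mul_finRotate_symm (π : Equiv.Perm (Fin (K + 1))) :
    endPattern (π * (finRotate (K + 1)).symm) = beginPattern π := by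
  unfold endPattern beginPattern
  congr 1
  funext j
  rw [Equiv.Perm.mul_apply]
  congr 1
  rw [Equiv.symm_apply_eq]
  exact (finRotate_of_lt (n := K) j.2).symm

theorem uniform_mem_flowPolytope :
    (fun _ => (Fintype.card (Equiv.Perm (Fin (K + 1))) : ℝ)⁻¹) ∈
      (overlapGraph (K + 1)).flowPolytope := by
  refine DiMultigraph.mem_flowPolytope_of_nonneg (fun _ => by positivity) ?_ fun ρ => ?_
  · rw [Finset.sum_const, nsmul_eq_mul, Finset.card_univ]
    exact mul_inv_cancel₀ (by simp [Fintype.card_ne_zero])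
  · refine Finset.sum_bij (fun π _ => π * (finRotate (K + 1)).symm) ?_ ?_ ?_ ?_
    · intro π hπ
      rw [Finset.mem_filter] at hπ ⊢
      exact ⟨Finset.mem_univ _, (endPattern_mul_finRotate_symm π).trans hπ.2⟩
    · intro π _ π' _ h
      exact mul_right_cancel h
    · intro π hπ
      refine ⟨π * finRotate (K + 1), ?_, ?_⟩
      · rw [Finset.mem_filter] at hπ ⊢
        refine ⟨Finset.mem_univ _, ?_⟩
        rw [← hπ.2]
        refine (endPattern_mul_finRotate_symm _).symm.trans (congrArg endPattern ?_)
        ext; simp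
      · ext; simp
    · intros; rfl

/-- Stacking `ρ'` after and above `ρ` gives a sequence whose successive windows form a walk from `ρ`
to `ρ'`, along which `h` is constant. -/
theorem overlapGraph_connected (h : Equiv.Perm (Fin K) → ℝ)
    (he : ∀ π : Equiv.Perm (Fin (K + 1)), h (beginPattern π) = h (endPattern π))
    (ρ ρ' : Equiv.Perm (Fin K)) : h ρ = h ρ' := by
  have hinj : ∀ τ : Equiv.Perm (Fin K),
      Function.Injective fun i : ℕ => (extendPerm τ i : ℚ) := fun τ =>
    Nat.cast_injective.comp (extendPerm_injective τ)
  have hpat : ∀ τ : Equiv.Perm (Fin K),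
      seqPattern K (fun i : ℕ => (extendPerm τ i : ℚ)) 0 = τ := by
    intro τ
    refine (std_eq_iff (injective_window (N := K) (hinj τ).injOn (by omega))).2 fun a b => ?_
    simp [extendPerm]
  obtain ⟨f, hf, hlo, hhi⟩ := exists_concat (fun i : ℕ => (extendPerm ρ i : ℚ))
    (fun i : ℕ => (extendPerm ρ' i : ℚ)) (n₁ := K) (N := K) (hinj ρ).injOn (hinj ρ').injOn
  have hstep : ∀ i ≤ K, h (seqPattern K f i) = h ρ := by
    intro i hi
    induction i with
    | zero =>
      rw [seqPattern_congr (f := f) (g := fun i : ℕ => (extendPerm ρ i : ℚ)) (i' := 0)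
        fun j hj => hlo _ (by omega), hpat]
    | succ i ih =>
      have hw : Function.Injective fun j : Fin (K + 1) => f (i + j) :=
        injective_window hf (by omega)
      rw [← ih (by omega), ← endPattern_seqPattern hw, ← beginPattern_seqPattern hw]
      exact (he _).symm
  rw [← hstep K le_rfl, ← hpat ρ', ← hhi K 0 (by omega), add_zero]

end OverlapGraph

end ConsecutivePatterns

theorem mainTheorem1 (k : ℕ) (hk : 2 ≤ k) :
    ConsecutivePatterns.feasibleRegion k =
        (ConsecutivePatterns.overlapGraph k).cyclePolytope ∧
    ConsecutivePatterns.IsVertexSet (ConsecutivePatterns.feasibleRegion k)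
        (ConsecutivePatterns.overlapGraph k).simpleCycleVectors ∧
    Set.extremePoints ℝ (ConsecutivePatterns.feasibleRegion k) =
        (ConsecutivePatterns.overlapGraph k).simpleCycleVectors ∧
    (Module.finrank ℝ (affineSpan ℝ (ConsecutivePatterns.feasibleRegion k)).direction : ℤ) =
        (k ! : ℤ) - ((k - 1)! : ℤ) ∧
    ConsecutivePatterns.feasibleRegion k =
      {v : Equiv.Perm (Fin k) → ℝ |
        (∀ π, v π ∈ Set.Icc (0 : ℝ) 1) ∧
        ∑ π, v π = 1 ∧
        ∀ ρ : Equiv.Perm (Fin (k - 1)),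
          ∑ π with ConsecutivePatterns.beginPattern π = ρ, v π =
            ∑ π with ConsecutivePatterns.endPattern π = ρ, v π} := by
  -- With `k = K + 1`, the size `k - 1` reduces definitionally to `K`.
  obtain ⟨K, rfl⟩ : ∃ K, k = K + 1 := ⟨k - 1, by omega⟩
  rw [ConsecutivePatterns.feasibleRegion_eq_flowPolytope]
  refine ⟨ConsecutivePatterns.DiMultigraph.flowPolytope_eq_cyclePolytope,
    ConsecutivePatterns.DiMultigraph.isVertexSet_flowPolytope,
    ConsecutivePatterns.DiMultigraph.extremePoints_flowPolytope, ?_, rfl⟩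
  have h := ConsecutivePatterns.DiMultigraph.finrank_direction_flowPolytope
    (ConsecutivePatterns.overlapGraph (K + 1))
    ConsecutivePatterns.uniform_mem_flowPolytope
    (fun _ => inv_pos.2 (by exact_mod_cast Fintype.card_pos))
    ConsecutivePatterns.beginPattern_one_eq_endPattern_one
    ConsecutivePatterns.overlapGraph_connected
  rw [Fintype.card_perm, Fintype.card_perm, Fintype.card_fin, Fintype.card_fin] at h
  rw [← h]
  push_cast
  ring
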